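/- Lemma 3.1. Let $A,B\in\mathbb Z$ be such that $E: y^2=x^3+Ax^2+Bx$ is an elliptic curve over $\mathbb Q$, and let $E': y^2=x^3-2Ax^2+(A^2-4B)x$. Let $C=\{O,(0,0)\}\subset E$, and let $\phi:E\to E'$ be the isogeny with kernel $C$ given by $\phi(x,y)=\left(\left(\tfrac yx\right)^2,\ \tfrac{y(B-x^2)}{x^2}\right)$ for $(x,y)\notin C$. For a nonzero integer $d$ let $E^d: y^2=x^3+dAx^2+d^2Bx$ and $E'^d: y^2=x^3-2dAx^2+d^2(A^2-4B)x$ be the quadratic twists of $E$ and $E'$ by $d$, let $C^d=\{O,(0,0)\}\subset E^d$, and let $\phi:E^d\to E'^d$ be the isogeny with kernel $C^d$ given by the same formula with $d^2B$ in place of $B$. For a prime $p$ let $H^1_\phi(\mathbb Q_p,C^d)\subset H^1(\mathbb Q_p,C^d)$ be the image of $E'^d(\mathbb Q_p)/\phi(E^d(\mathbb Q_p))$ under the connecting map $\delta$, where $\delta(Q)$ is the class of the cocycle $\sigma\mapsto\sigma(R)-R$ for any $R\in E^d(\overline{\mathbb Q}_p)$ with $\phi(R)=Q$. It is an $\mathbb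 F_2$-subspace of $H^1(\mathbb Q_p,C^d)$. Suppose $p\neq 2$ is a prime where $E$ has good reduction and $d\in\mathbb Z$ is squarefree with $p\mid d$. (i) If $E(\mathbb Q_p)[2]\simeq\mathbb Z/2\mathbb Z\simeq E'(\mathbb Q_p)[2]$, then $\dim_{\mathbb F_2}H^1_\phi(\mathbb Q_p,C^d)=1$. (ii) If $E(\mathbb Q_p)[2]\simeq\mathbb Z/2\mathbb Z\times\mathbb Z/2\mathbb Z\simeq E'(\mathbb Q_p)[2]$, then $\dim_{\mathbb F_2}H^1_\phi(\mathbb Q_p,C^d)=1$. (iii) If $E(\mathbb Q_p)[2]\simeq\mathbb Z/2\mathbb Z$ and $E'(\mathbb Q_p)[2]\simeq\mathbb Z/2\mathbb Z\times\mathbb Z/2\mathbb Z$, then $\dim_{\mathbb F_2}H^1_\phi(\mathbb Q_p,C^d)=2$. (iv) If $E(\mathbb Q_p)[2]\simeq\mathbb Z/2\mathbb Z\times\mathbb Z/2\mathbb Z$ and $E'(\mathbb Q_p)[2]\simeq\mathbb Z/2\mathbb Z$, then $\dim_{\mathbb F_2}H^1_\phi(\mathbb Q_p,C^d)=0$. 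-/

import Mathlib

open scoped Classical

noncomputable section

namespace TwoIsogeny

open WeierstrassCurve

/-! ### Continuous group cohomology in degree one -/

section Cohomology

variable (G M : Type*) [Group G] [TopologicalSpace G] [AddCommGroup M] [DistribMulAction G M]

/-- Continuous 1-cocycles (crossed homomorphisms) of a topological group `G` with values in a
discrete `G`-module `M`; continuity for the discrete topology on `M` is local constancy. -/
def Z1 : AddSubgroup (G → M) where
  carrier := {f | IsLocallyConstant f ∧ ∀ σ τ : G, f (σ * τ) = f σ + σ • f τ}
  zero_mem' := ⟨IsLocallyConstant.const 0, fun σ τ => by simp⟩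
  add_mem' := by
    rintro f g ⟨hf, hf'⟩ ⟨hg, hg'⟩
    refine ⟨hf.add hg, fun σ τ => ?_⟩
    simp only [Pi.add_apply, hf', hg', smul_add]
    abel
  neg_mem' := by
    rintro f ⟨hf, hf'⟩
    refine ⟨hf.neg, fun σ τ => ?_⟩
    simp only [Pi.neg_apply, hf', smul_neg]
    abel

/-- The principal crossed homomorphisms `σ ↦ σ • m - m`, inside the continuous 1-cocycles. -/
def B1 : AddSubgroup (Z1 G M) where
  carrier := {f | ∃ m : M, ∀ σ : G, (f : G → M) σ = σ • m - m}
  zero_mem' := ⟨0, fun σ => by simp⟩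
  add_mem' := by
    rintro f g ⟨m, hm⟩ ⟨n, hn⟩
    refine ⟨m + n, fun σ => ?_⟩
    simp only [AddSubgroup.coe_add, Pi.add_apply, hm, hn, smul_add]
    abel
  neg_mem' := by
    rintro f ⟨m, hm⟩
    refine ⟨-m, fun σ => ?_⟩
    simp only [AddSubgroup.coe_neg, Pi.neg_apply, hm, smul_neg]
    abel

/-- The first continuous cohomology group `H¹(G, M)` of a discrete `G`-module `M`. -/
abbrev H1 : Type _ := Z1 G M ⧸ B1 G M

end Cohomology

/-! ### Galois action on points -/

/-- The base change to a field `F` of a Weierstrass curve with coefficients in `ℤ`. -/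
abbrev bc (W : WeierstrassCurve ℤ) (F : Type*) [Field F] : WeierstrassCurve F := W⁄F

/-- The group `W(F)` of `F`-points of a Weierstrass curve `W` with coefficients in `ℤ`
(points at which `W` is singular over `F`, if any, are excluded). -/
abbrev Pt (W : WeierstrassCurve ℤ) (F : Type*) [Field F] : Type _ := (bc W F).toAffine.Point

/-- The group homomorphism `W(F) → W(L)` induced by a homomorphism of fields `F → L`. -/
abbrev ptMap (W : WeierstrassCurve ℤ) {F L : Type*} [Field F] [Field L] (f : F →+* L) :
    Pt W F →+ Pt W L :=
  Affine.Point.map (W' := W) f.toIntAlgHom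

section Galois

variable (K : Type*) [Field K]

/-- The absolute Galois group `Gal(K̄/K)`, with its Krull topology. -/
abbrev GalK : Type _ := AlgebraicClosure K ≃ₐ[K] AlgebraicClosure K

/-- `Gal(K̄/K)` acts on the `K̄`-points of a Weierstrass curve with coefficients in `ℤ`
through the coordinates. -/
instance galoisActionPoint (W : WeierstrassCurve ℤ) :
    DistribMulAction (GalK K) (Pt W (AlgebraicClosure K)) where
  smul σ R := ptMap W (σ : AlgebraicClosure K →+* AlgebraicClosure K) R
  one_smul R := by
    change ptMap W _ R = R
    cases R <;> rfl
  mul_smul σ τ R := by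
    change ptMap W _ R =
      ptMap W _ (ptMap W _ R)
    cases R <;> rfl
  smul_zero σ := rfl
  smul_add σ R S := map_add (ptMap W (σ : AlgebraicClosure K →+* AlgebraicClosure K)) R S

end Galois

/-! ### Curves with a marked two-torsion point -/

/-- The Weierstrass curve `E : y² = x³ + A x² + B x`. -/
def curve (A B : ℤ) : WeierstrassCurve ℤ := ⟨0, A, 0, B, 0⟩

/-- The curve `E' : y² = x³ - 2 A x² + (A² - 4 B) x`, the target of the isogeny `φ`. -/
def isogCurve (A B : ℤ) : WeierstrassCurve ℤ := curve (-2 * A) (A ^ 2 - 4 * B)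

section Points

variable (A B : ℤ) (F : Type*) [Field F]

lemma nonsingular_curve_iff (x y : F) : (bc (curve A B) F).toAffine.Nonsingular x y ↔
    y ^ 2 = x ^ 3 + A * x ^ 2 + B * x ∧ (3 * x ^ 2 + 2 * A * x + B ≠ 0 ∨ 2 * y ≠ 0) := by
  rw [Affine.nonsingular_iff', Affine.equation_iff]
  simp [curve, WeierstrassCurve.baseChange, WeierstrassCurve.map]
  grind

variable {A B F} in
/-- The formula defining `φ` sends points of `E` with `x ≠ 0` to points of `E'`. -/
lemma nonsingular_isog {x y : F} (h : (bc (curve A B) F).toAffine.Nonsingular x y) (hx : x ≠ 0) :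
    (bc (isogCurve A B) F).toAffine.Nonsingular (y ^ 2 / x ^ 2) (y * (B - x ^ 2) / x ^ 2) := by
  rw [nonsingular_curve_iff] at h
  rw [isogCurve, nonsingular_curve_iff]
  obtain ⟨h1, h2⟩ := h
  set X : F := y ^ 2 / x ^ 2 with hX
  have hX' : X * x = x ^ 2 + A * x + B := by
    rw [hX, h1]; field_simp
  have hXx : X * x ^ 2 = y ^ 2 := by rw [hX]; field_simp
  push_cast
  refine ⟨?_, ?_⟩
  · have h3 : (y * (B - x ^ 2) / x ^ 2) ^ 2 = X * ((B - x ^ 2) / x) ^ 2 := by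
      rw [hX]; field_simp
    rw [h3]
    have hB : (B : F) = X * x - x ^ 2 - A * x := by rw [hX']; ring
    rw [hB]; field_simp; ring
  · by_contra! hcon
    obtain ⟨h4, h5⟩ := hcon
    by_cases two : (2 : F) = 0
    · have h7 : (X - A) ^ 2 = 0 := by
        linear_combination h4 - (X ^ 2 - A * X - 2 * B) * two
      have h8 : X = A := sub_eq_zero.1 (pow_eq_zero_iff two_ne_zero |>.1 h7)
      rw [h8] at hX'
      rcases h2 with h2 | h2
      · exact h2 (by linear_combination -hX' + (x ^ 2 + A * x) * two)
      · exact h2 (by rw [two, zero_mul])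
    · have h6 : y * ((B : F) - x ^ 2) = 0 := by
        rcases mul_eq_zero.1 h5 with h | h
        · exact absurd h two
        · exact (div_eq_zero_iff.1 h).resolve_right (pow_ne_zero 2 hx)
      have key : y = 0 ∧ 2 * x + (A : F) = 0 := by
        rcases mul_eq_zero.1 h6 with h | h
        · refine ⟨h, ?_⟩
          have hX0 : X = 0 := by rw [hX, h]; simp
          rw [hX0] at hX' h4
          exact pow_eq_zero_iff two_ne_zero |>.1
            (by linear_combination h4 - 4 * hX' : (2 * x + (A : F)) ^ 2 = 0)
        · have hXe : X = 2 * x + A := mul_right_cancel₀ hx (by linear_combination hX' + h)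
          have h9 : (2 * 2 * x) * (2 * x + (A : F)) = 0 := by
            rw [hXe] at h4; linear_combination h4 + 4 * h
          have h10 := (mul_eq_zero.1 h9).resolve_left
            (mul_ne_zero (mul_ne_zero two two) hx)
          refine ⟨?_, h10⟩
          rw [hXe, h10, zero_mul] at hXx
          exact pow_eq_zero_iff two_ne_zero |>.1 hXx.symm
      obtain ⟨rfl, h10⟩ := key
      rcases h2 with h2 | h2
      · apply h2
        have hX0 : X = 0 := by rw [hX]; simp
        rw [hX0] at hX'
        linear_combination x * h10 - hX'
      · exact h2 (mul_zero 2)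

variable {F} in
/-- The isogeny `φ : E → E'`, given on points by
`φ (x, y) = ((y / x)², y (B - x²) / x²)` away from `O` and `(0, 0)`, which are sent to `O`. -/
def isog : Pt (curve A B) F → Pt (isogCurve A B) F
  | .zero => 0
  | .some x _ h => if hx : x = 0 then 0 else .some _ _ (nonsingular_isog h hx)

/-- The subgroup `C = {O, (0, 0)}` of `E`, the kernel of `φ`. -/
def kerC : AddSubgroup (Pt (curve A B) F) where
  carrier := {R | R = 0 ∨ ∃ h, R = .some 0 0 h}
  zero_mem' := Or.inl rfl
  add_mem' := by
    rintro R S (rfl | ⟨h, rfl⟩) (rfl | ⟨h', rfl⟩)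
    · exact Or.inl (add_zero _)
    · exact Or.inr ⟨h', zero_add _⟩
    · exact Or.inr ⟨h, add_zero _⟩
    · refine Or.inl (Affine.Point.add_self_of_Y_eq ?_)
      simp [Affine.negY, curve, WeierstrassCurve.baseChange, WeierstrassCurve.map]
  neg_mem' := by
    rintro R (rfl | ⟨h, rfl⟩)
    · exact Or.inl neg_zero
    · refine Or.inr ⟨h, ?_⟩
      rw [Affine.Point.neg_some]
      simp [Affine.negY, curve, WeierstrassCurve.baseChange, WeierstrassCurve.map]

lemma two_nsmul_kerC (c : kerC A B F) : 2 • c = 0 := by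
  obtain ⟨R, rfl | ⟨h, rfl⟩⟩ := c
  · exact nsmul_zero 2
  · apply Subtype.ext
    rw [two_nsmul]
    refine Affine.Point.add_self_of_Y_eq ?_
    simp [Affine.negY, curve, WeierstrassCurve.baseChange, WeierstrassCurve.map]

end Points

/-! ### The local condition -/

section LocalCondition

variable (A B : ℤ) (K : Type*) [Field K]

/-- `C` as a Galois module: the two points of `C` are fixed by Galois, so `C ⊆ E(K̄)` is stable. -/
instance galoisActionKerC : DistribMulAction (GalK K) (kerC A B (AlgebraicClosure K)) where
  smul σ c := ⟨σ • (c : Pt (curve A B) (AlgebraicClosure K)), by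
    obtain ⟨R, rfl | ⟨h, rfl⟩⟩ := c
    · exact Or.inl (smul_zero σ)
    · have key : σ • (Affine.Point.some 0 0 h : Pt (curve A B) (AlgebraicClosure K)) =
          Affine.Point.some 0 0 h := by
        change Affine.Point.some _ _ _ = _
        simp
      exact Or.inr ⟨h, key⟩⟩
  one_smul c := Subtype.ext (one_smul (GalK K) _)
  mul_smul σ τ c := Subtype.ext (mul_smul σ τ _)
  smul_zero σ := Subtype.ext (smul_zero σ)
  smul_add σ c c' := Subtype.ext (smul_add σ _ _)

/-- The Galois cohomology group `H¹(K, C)`. -/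
abbrev H1C : Type _ := H1 (GalK K) (kerC A B (AlgebraicClosure K))

/-- `H¹(K, C)` is a vector space over `𝔽₂`, since `C` is killed by `2`. -/
instance : Module (ZMod 2) (H1C A B K) :=
  QuotientAddGroup.zmodModule fun z => by
    have : 2 • z = 0 := Subtype.ext (funext fun σ => two_nsmul_kerC A B _ _)
    rw [this]
    exact zero_mem _

/-- `H¹_φ(K, C) ⊆ H¹(K, C)`: the image of the connecting map
`δ : E'(K) / φ(E(K)) → H¹(K, C)`. Here `δ(Q)` is the class of the cocycle `σ ↦ σ(R) - R`, where
`R` is any point of `E(K̄)` with `φ(R) = Q`. -/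
def localCondition : Set (H1C A B K) :=
  {c | ∃ (Q : Pt (isogCurve A B) K) (R : Pt (curve A B) (AlgebraicClosure K))
      (z : Z1 (GalK K) (kerC A B (AlgebraicClosure K))),
    isog A B R = ptMap (isogCurve A B) (algebraMap K (AlgebraicClosure K)) Q ∧
    (∀ σ : GalK K, (((z : GalK K → kerC A B (AlgebraicClosure K)) σ :
      kerC A B (AlgebraicClosure K)) : Pt (curve A B) (AlgebraicClosure K)) = σ • R - R) ∧
    c = QuotientAddGroup.mk z}

end LocalCondition

/-- `S` is an `𝔽₂`-linear subspace, of dimension `n`, of the `𝔽₂`-vector space `V`. -/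
def IsSubspaceOfDim {V : Type*} [AddCommGroup V] [Module (ZMod 2) V] (S : Set V) (n : ℕ) : Prop :=
  ∃ U : Submodule (ZMod 2) V, (U : Set V) = S ∧ Module.rank (ZMod 2) U = n

/-- The curve `E : y² = x³ + A x² + B x` has good reduction at `p`: over `ℚ_p` it has a
(minimal) Weierstrass equation with good reduction. -/
def GoodReductionAt (A B : ℤ) (p : ℕ) [Fact p.Prime] : Prop :=
  ∃ V : VariableChange ℚ_[p], (V • (bc (curve A B) ℚ_[p])).HasGoodReduction ℤ_[p]

/-- `E(ℚ_p)[2] ≃ ℤ/2` for a Weierstrass curve `W` over `ℤ`. -/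
def TwoTorsionCyclic (W : WeierstrassCurve ℤ) (p : ℕ) [Fact p.Prime] : Prop :=
  Nonempty (AddSubgroup.torsionBy (Pt W ℚ_[p]) 2 ≃+ ZMod 2)

/-- `E(ℚ_p)[2] ≃ ℤ/2 × ℤ/2` for a Weierstrass curve `W` over `ℤ`. -/
def TwoTorsionFull (W : WeierstrassCurve ℤ) (p : ℕ) [Fact p.Prime] : Prop :=
  Nonempty (AddSubgroup.torsionBy (Pt W ℚ_[p]) 2 ≃+ ZMod 2 × ZMod 2)

/-- The quadratic twist `E^d : y² = x³ + d A x² + d² B x` of `E : y² = x³ + A x² + B x`. -/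
def twist (A B d : ℤ) : WeierstrassCurve ℤ := curve (d * A) (d ^ 2 * B)

/-- `E` and `E^d` become isomorphic, by `(x, y) ↦ (s² x, s³ y)`, where `d = s²` is a square. -/
lemma twist_baseChange (A B d : ℤ) (F : Type*) [Field F] (s : Fˣ) (hs : (s : F) ^ 2 = d) :
    (⟨s⁻¹, 0, 0, 0⟩ : VariableChange F) • (bc (curve A B) F) = bc (twist A B d) F := by
  rw [variableChange_def]
  ext <;> simp [curve, twist, WeierstrassCurve.baseChange, WeierstrassCurve.map, ← hs]
  left
  ring

/-- The target `E'^d` of the isogeny `φ` on `E^d` is the quadratic twist by `d` of `E'`. -/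
lemma isogCurve_twist (A B d : ℤ) :
    isogCurve (d * A) (d ^ 2 * B) = twist (-2 * A) (A ^ 2 - 4 * B) d := by
  rw [isogCurve, twist]
  congr 1 <;> ring

/-- The local condition `H¹_φ(ℚ_p, C^d) ⊆ H¹(ℚ_p, C^d)` attached to the isogeny `φ : E^d → E'^d`
with kernel `C^d = {O, (0, 0)} ⊆ E^d`, where `E^d : y² = x³ + d A x² + d² B x` is the quadratic
twist of `E` by `d`. -/
def twistLocalCondition (A B d : ℤ) (p : ℕ) [Fact p.Prime] :
    Set (H1C (d * A) (d ^ 2 * B) ℚ_[p]) :=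
  localCondition (d * A) (d ^ 2 * B) ℚ_[p]

end TwoIsogeny

end

/-!
The image of the connecting map is computed by explicit 2-descent. Since Galois acts trivially on
`C`, every `u ∈ Kˣ` gives a quadratic character with values in `C`, hence a class `kummer u` in
`H¹(K, C)`; this is multiplicative in `u` and vanishes exactly on squares (`kummer_mul`,
`kummer_eq_zero_iff`). If `φ(x, y) = (X, Y)` with `X ≠ 0`, then `(y / x)² = X`, and `σ` fixes
`(x, y)` if and only if it fixes `y / x`; so the class of `(X, Y)` is `kummer X`. The points `O` and
`(0, 0)` of `E'` give the classes of `1` and `A² - 4B`. Hence the local condition is the image under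
`kummer` of an explicit set of abscissas (`localCondition_eq`).

Good reduction allows one to rescale `E` so that `B` and `c = A² - 4B` are `p`-adic units and `A` is
integral (`exists_scaling_of_goodReduction`). As `d` is a uniformizer, writing `X = d t` the equation
of `E'^d` becomes `Y² = d³ t (t² - 2 A t + c)`, and valuations and Hensel's lemma leave three cases
(`square_class_of_twisted_point`): if `|t| > 1` then `X` is a square, if `|t| < 1` then `X c` is a
square, and if `t` is a unit then, by parity of valuations, `t` reduces to a root of the quadratic
factor. The last case requires `B` to be a square; the root lifts to `r = A ± 2 √B`, and `X` has the
class of `d r`, the abscissa of a 2-torsion point of `E'^d`. So the classes are `1` and `c`, together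
with `d r` and `c d r` when `B` is a square (`kummer_image_twist`). Here `d r` has odd valuation, so
it is neither a square nor a square times `c`. As `E` (resp. `E'`) has full rational 2-torsion
exactly when `c` (resp. `B`) is a square, the four dimensions follow by counting.
-/

noncomputable section

namespace TwoIsogeny

open WeierstrassCurve

/-! ### The Kummer map into `H¹(K, C)` -/

section Kummer

variable {A B : ℤ} {K : Type*} [Field K]

lemma smul_kerC (σ : GalK K) (c : kerC A B (AlgebraicClosure K)) : σ • c = c := by
  obtain ⟨R, rfl | ⟨h, rfl⟩⟩ := c
  · exact smul_zero σ
  · apply Subtype.ext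
    change Affine.Point.some _ _ _ = _
    simp

lemma nonsingular_zero (F : Type*) [Field F] (hB : (B : F) ≠ 0) :
    (bc (curve A B) F).toAffine.Nonsingular 0 0 := by
  rw [nonsingular_curve_iff]
  exact ⟨by ring, Or.inl (by simpa using hB)⟩

/-- The point `(0, 0)` of `E`, as an element of `C`. -/
def kerPt (A B : ℤ) (F : Type*) [Field F] (hB : (B : F) ≠ 0) : kerC A B F :=
  ⟨.some 0 0 (nonsingular_zero F hB), Or.inr ⟨_, rfl⟩⟩

lemma kerPt_ne_zero {F : Type*} [Field F] (hB : (B : F) ≠ 0) : kerPt A B F hB ≠ 0 :=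
  fun h => Affine.Point.some_ne_zero _ (congrArg Subtype.val h)

lemma eq_zero_or_kerPt {F : Type*} [Field F] (hB : (B : F) ≠ 0) (c : kerC A B F) :
    c = 0 ∨ c = kerPt A B F hB := by
  obtain ⟨R, rfl | ⟨h, rfl⟩⟩ := c
  · exact Or.inl rfl
  · exact Or.inr rfl

lemma kerPt_add_self {F : Type*} [Field F] (hB : (B : F) ≠ 0) :
    kerPt A B F hB + kerPt A B F hB = 0 := by
  rw [← two_nsmul]; exact two_nsmul_kerC A B F _

lemma galK_apply_eq_or_neg (σ : GalK K) {u : K} {w : AlgebraicClosure K}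
    (hw : w ^ 2 = algebraMap K _ u) : σ w = w ∨ σ w = -w := by
  rw [← sq_eq_sq_iff_eq_or_eq_neg, ← map_pow, hw, AlgEquiv.commutes]

variable (K) in
/-- A chosen square root of `u` in the algebraic closure of `K`. -/
def sqrtAC (u : K) : AlgebraicClosure K :=
  (IsAlgClosed.exists_pow_nat_eq (algebraMap K (AlgebraicClosure K) u) two_pos).choose

lemma sqrtAC_sq (u : K) : sqrtAC K u ^ 2 = algebraMap K _ u :=
  (IsAlgClosed.exists_pow_nat_eq (algebraMap K (AlgebraicClosure K) u) two_pos).choose_spec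

lemma galK_fix_iff_sqrtAC (σ : GalK K) {u : K} {w : AlgebraicClosure K}
    (hw : w ^ 2 = algebraMap K _ u) : σ (sqrtAC K u) = sqrtAC K u ↔ σ w = w := by
  rcases sq_eq_sq_iff_eq_or_eq_neg.1 ((sqrtAC_sq u).trans hw.symm) with h | h
  · rw [h]
  · rw [h, map_neg, neg_inj]

lemma isLocallyConstant_ite_fix {M : Type*} (w : AlgebraicClosure K) (m n : M) :
    IsLocallyConstant fun σ : GalK K => if σ w = w then m else n := by
  have hopen : IsOpen {σ : GalK K | σ w = w} := stabilizer_isOpen_of_isIntegral w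
  have hclosed : IsClosed {σ : GalK K | σ w = w} :=
    Subgroup.isClosed_of_isOpen (MulAction.stabilizer (GalK K) w) hopen
  intro s
  have : (fun σ : GalK K => if σ w = w then m else n) ⁻¹' s =
      ({σ | σ w = w} ∩ {_σ | m ∈ s}) ∪ ({σ | σ w = w}ᶜ ∩ {_σ | n ∈ s}) := by
    ext σ
    by_cases h : σ w = w <;> simp [h]
  rw [this]
  exact (hopen.inter isOpen_const).union (hclosed.isOpen_compl.inter isOpen_const)

variable (hB : (B : AlgebraicClosure K) ≠ 0)

variable (A) in
/-- The quadratic character of `u`, as a cocycle with values in `C`: it sends `σ` to `(0, 0)` if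
`σ` moves `√u`, and to `O` otherwise. At the degenerate value `u = 0` it is the zero cocycle. -/
def kummerCocycle (u : K) : Z1 (GalK K) (kerC A B (AlgebraicClosure K)) :=
  ⟨fun σ => if σ (sqrtAC K u) = sqrtAC K u then 0 else kerPt A B _ hB, by
    refine ⟨isLocallyConstant_ite_fix _ _ _, fun σ τ => ?_⟩
    rw [smul_kerC]
    simp only [AlgEquiv.mul_apply]
    set w := sqrtAC K u with hw
    have h1 := galK_apply_eq_or_neg σ (sqrtAC_sq u)
    have h2 := galK_apply_eq_or_neg τ (sqrtAC_sq u)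
    rw [← hw] at h1 h2
    -- in characteristic two, or for `u = 0`, everything is fixed
    by_cases h0 : w = -w
    · have e1 : σ w = w := by rcases h1 with h | h; exacts [h, h.trans h0.symm]
      have e2 : τ w = w := by rcases h2 with h | h; exacts [h, h.trans h0.symm]
      simp [e1, e2]
    · rcases h1 with h1 | h1 <;> rcases h2 with h2 | h2 <;>
        simp [h1, h2, Ne.symm h0, kerPt_add_self]⟩

lemma kummerCocycle_apply {u : K} {w : AlgebraicClosure K} (hw : w ^ 2 = algebraMap K _ u)
    (σ : GalK K) :
    (kummerCocycle A hB u : GalK K → kerC A B (AlgebraicClosure K)) σ =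
      if σ w = w then 0 else kerPt A B _ hB := by
  simp only [← galK_fix_iff_sqrtAC σ hw]; rfl

variable (A) in
/-- The class in `H¹(K, C)` of the quadratic character of `u`. -/
def kummer (u : K) : H1C A B K := QuotientAddGroup.mk (kummerCocycle A hB u)

variable [CharZero K]

lemma kummer_mul {u v : K} (hu : u ≠ 0) (hv : v ≠ 0) :
    kummer A hB (u * v) = kummer A hB u + kummer A hB v := by
  rw [kummer, kummer, kummer, ← QuotientAddGroup.mk_add]
  congr 1
  apply Subtype.ext
  funext σ
  have hw : (sqrtAC K u * sqrtAC K v) ^ 2 = algebraMap K _ (u * v) := by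
    rw [mul_pow, sqrtAC_sq, sqrtAC_sq, map_mul]
  have ne {t : K} (ht : t ≠ 0) : sqrtAC K t ≠ 0 := fun h => ht <| by
    have := sqrtAC_sq t
    rw [h, zero_pow two_ne_zero] at this
    exact (map_eq_zero _).1 this.symm
  rw [AddSubgroup.coe_add, Pi.add_apply, kummerCocycle_apply hB hw,
    kummerCocycle_apply hB (sqrtAC_sq u), kummerCocycle_apply hB (sqrtAC_sq v), map_mul]
  have hu' := ne hu
  have hv' := ne hv
  have huv := mul_ne_zero hu' hv'
  rcases galK_apply_eq_or_neg σ (sqrtAC_sq u) with h1 | h1 <;>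
    rcases galK_apply_eq_or_neg σ (sqrtAC_sq v) with h2 | h2 <;>
    simp [h1, h2, neg_eq_self, hu', hv', huv, kerPt_add_self]

lemma kummer_eq_zero_iff {u : K} : kummer A hB u = 0 ↔ IsSquare u := by
  rw [kummer, QuotientAddGroup.eq_zero_iff]
  constructor
  · rintro ⟨m, hm⟩
    have hfix (σ : GalK K) : σ (sqrtAC K u) = sqrtAC K u := by
      by_contra h
      have := hm σ
      rw [kummerCocycle_apply hB (sqrtAC_sq u), if_neg h, smul_kerC, sub_self] at this
      exact kerPt_ne_zero hB this
    obtain ⟨v, hv⟩ := IntermediateField.mem_bot.1 <|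
      (InfiniteGalois.mem_bot_iff_fixed (k := K) (sqrtAC K u)).2 hfix
    refine ⟨v, (algebraMap K (AlgebraicClosure K)).injective ?_⟩
    rw [← sqrtAC_sq, ← hv, map_mul, sq]
  · rintro ⟨v, rfl⟩
    refine ⟨0, fun σ => ?_⟩
    rw [kummerCocycle_apply hB (w := algebraMap K _ v) (by rw [map_mul, sq]), AlgEquiv.commutes]
    simp

lemma kummer_eq_iff {u v : K} (hu : u ≠ 0) (hv : v ≠ 0) :
    kummer A hB u = kummer A hB v ↔ IsSquare (u * v) := by
  have h2 : kummer A hB v + kummer A hB v = 0 := by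
    rw [← kummer_mul hB hv hv, kummer_eq_zero_iff]; exact ⟨v, rfl⟩
  rw [← kummer_eq_zero_iff (A := A) hB, kummer_mul hB hu hv, ← sub_eq_zero, sub_eq_add_neg,
    ← eq_neg_of_add_eq_zero_left h2]

end Kummer

/-! ### Translation by `(0, 0)` -/

section Translation

variable {A B : ℤ} {F : Type*} [Field F]

lemma kerPt_add_some (hB : (B : F) ≠ 0) {x y : F} (hx : x ≠ 0)
    (h : (bc (curve A B) F).toAffine.Nonsingular x y) :
    ∃ h', (kerPt A B F hB : Pt (curve A B) F) + .some x y h =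
      .some ((B : F) / x) (-B * y / x ^ 2) h' := by
  have hE := ((nonsingular_curve_iff ..).1 h).1
  have key : (kerPt A B F hB : Pt (curve A B) F) + .some x y h = _ :=
    Affine.Point.add_of_X_ne (Ne.symm hx)
  have hsl : (bc (curve A B) F).toAffine.slope 0 x 0 y = y / x := by
    rw [Affine.slope_of_X_ne (Ne.symm hx)]; simp [neg_div_neg_eq]
  have e1 : (bc (curve A B) F).toAffine.addX 0 x
      ((bc (curve A B) F).toAffine.slope 0 x 0 y) = (B : F) / x := by
    rw [hsl]
    simp [Affine.addX, curve, WeierstrassCurve.baseChange, WeierstrassCurve.map]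
    field_simp
    linear_combination hE
  have e2 : (bc (curve A B) F).toAffine.addY 0 x 0
      ((bc (curve A B) F).toAffine.slope 0 x 0 y) = -B * y / x ^ 2 := by
    rw [Affine.addY, Affine.negAddY, e1, hsl]
    simp [Affine.negY, curve, WeierstrassCurve.baseChange, WeierstrassCurve.map]
    field_simp
  simp only [e1, e2] at key
  exact ⟨_, key⟩

end Translation

/-! ### The image of the connecting map -/

section Image

variable {A B : ℤ} {K : Type*} [Field K]

/-- The elements of `Kˣ` whose square classes are the classes of the 2-descent on `E'(K)`: a point
with nonzero abscissa contributes its abscissa, while `O` and `(0, 0)`, which have no nonzero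
abscissa, contribute `1` and `A² - 4B`. -/
def descentSet (A B : ℤ) (K : Type*) [Field K] : Set K :=
  {u | u = 1 ∨ u = A ^ 2 - 4 * B ∨
    u ≠ 0 ∧ ∃ Y : K, Y ^ 2 = u * (u ^ 2 - 2 * A * u + (A ^ 2 - 4 * B))}

-- Numerals in `AlgebraicClosure K` are not seen by `simp` through `map_ofNat`.
lemma algebraMap_ofNat_two : algebraMap K (AlgebraicClosure K) 2 = 2 := map_ofNat _ 2

lemma algebraMap_ofNat_four : algebraMap K (AlgebraicClosure K) 4 = 4 := map_ofNat _ 4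

lemma galK_two (σ : GalK K) : σ 2 = 2 := map_ofNat σ 2

variable (hB : (B : AlgebraicClosure K) ≠ 0)

/-- A cocycle of the form `σ ↦ σ R - R` is determined by which `σ` fix `R`. -/
lemma eq_kummerCocycle_of_fix_iff {R : Pt (curve A B) (AlgebraicClosure K)}
    {z : Z1 (GalK K) (kerC A B (AlgebraicClosure K))}
    (hz : ∀ σ : GalK K, (((z : GalK K → kerC A B (AlgebraicClosure K)) σ :
      kerC A B (AlgebraicClosure K)) : Pt (curve A B) (AlgebraicClosure K)) = σ • R - R)
    {u : K} {w : AlgebraicClosure K} (hw : w ^ 2 = algebraMap K _ u)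
    (h : ∀ σ : GalK K, σ w = w ↔ σ • R = R) : z = kummerCocycle A hB u := by
  apply Subtype.ext
  funext σ
  rw [kummerCocycle_apply hB hw]
  have h0 : (z : GalK K → kerC A B (AlgebraicClosure K)) σ = 0 ↔ σ w = w := by
    rw [h, ← sub_eq_zero (a := σ • R), ← hz, ZeroMemClass.coe_eq_zero]
  split_ifs with h1
  · exact h0.2 h1
  · exact (eq_zero_or_kerPt hB _).resolve_left (mt h0.1 h1)

lemma smul_some (σ : GalK K) {x y : AlgebraicClosure K}
    (h : (bc (curve A B) (AlgebraicClosure K)).toAffine.Nonsingular x y) :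
    ∃ h', σ • (Affine.Point.some x y h : Pt (curve A B) (AlgebraicClosure K)) =
      .some (σ x) (σ y) h' := ⟨_, rfl⟩

lemma smul_some_eq_iff (σ : GalK K) {x y : AlgebraicClosure K}
    (h : (bc (curve A B) (AlgebraicClosure K)).toAffine.Nonsingular x y) :
    σ • (Affine.Point.some x y h : Pt (curve A B) (AlgebraicClosure K)) = .some x y h ↔
      σ x = x ∧ σ y = y := by
  obtain ⟨h', e⟩ := smul_some σ h
  rw [e, Affine.Point.some.injEq]

lemma isog_some {F : Type*} [Field F] {x y : F}
    (h : (bc (curve A B) F).toAffine.Nonsingular x y) (hx : x ≠ 0) :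
    isog A B (.some x y h) = .some _ _ (nonsingular_isog h hx) := dif_neg hx

/-- If `σ` sends `R` to its translate by `(0, 0)`, then `σ R - R = (0, 0)`. -/
lemma kerPt_eq_smul_sub {σ : GalK K} {x y : AlgebraicClosure K} (hx : x ≠ 0)
    (h : (bc (curve A B) (AlgebraicClosure K)).toAffine.Nonsingular x y)
    (h1 : σ x = B / x) (h2 : σ y = -B * y / x ^ 2) :
    (kerPt A B _ hB : Pt (curve A B) (AlgebraicClosure K)) =
      σ • (Affine.Point.some x y h : Pt (curve A B) (AlgebraicClosure K)) - .some x y h := by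
  obtain ⟨h', e⟩ := kerPt_add_some hB hx h
  obtain ⟨h'', e'⟩ := smul_some σ h
  rw [eq_sub_iff_add_eq, e, e']
  simp only [h1, h2]

/-- A class is in the image of the connecting map as soon as a point of `E` over a `K`-point of
`E'` is moved by Galois through the corresponding quadratic character. -/
lemma kummer_mem_localCondition {u : K} {w : AlgebraicClosure K} (hw : w ^ 2 = algebraMap K _ u)
    {x y : AlgebraicClosure K} (hx : x ≠ 0)
    (h : (bc (curve A B) (AlgebraicClosure K)).toAffine.Nonsingular x y)
    {X Y : K} (hX : y ^ 2 / x ^ 2 = algebraMap K _ X)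
    (hY : y * (B - x ^ 2) / x ^ 2 = algebraMap K _ Y)
    (hXY : (bc (isogCurve A B) K).toAffine.Nonsingular X Y)
    (hfix : ∀ σ : GalK K, σ w = w → σ x = x ∧ σ y = y)
    (hmove : ∀ σ : GalK K, σ w = -w → σ x = B / x ∧ σ y = -B * y / x ^ 2) :
    kummer A hB u ∈ localCondition A B K := by
  refine ⟨.some X Y hXY, .some x y h, kummerCocycle A hB u, ?_, fun σ => ?_, rfl⟩
  · rw [isog_some h hx]
    refine (Affine.Point.some.injEq ..).mpr ⟨hX, hY⟩
  · rw [kummerCocycle_apply hB hw]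
    split_ifs with h1
    · rw [(smul_some_eq_iff σ h).2 (hfix σ h1), sub_self]; rfl
    · obtain ⟨h2, h3⟩ := hmove σ ((galK_apply_eq_or_neg σ hw).resolve_left h1)
      exact kerPt_eq_smul_sub hB hx h h2 h3

variable [CharZero K]

/-- The classes of the connecting map are quadratic characters of elements of the descent set. -/
lemma localCondition_subset : localCondition A B K ⊆ kummer A hB '' descentSet A B K := by
  rintro c ⟨Q, R, z, hQ, hz, rfl⟩
  have aux (h : R = 0 ∨ R = kerPt A B _ hB) :
      (QuotientAddGroup.mk z : H1C A B K) ∈ kummer A hB '' descentSet A B K := by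
    refine ⟨1, Or.inl rfl, ?_⟩
    rw [kummer, ← eq_kummerCocycle_of_fix_iff hB hz (w := 1) (by simp)]
    intro σ
    refine iff_of_true (map_one σ) ?_
    rcases h with rfl | rfl
    · exact smul_zero σ
    · exact congrArg Subtype.val (smul_kerC σ (kerPt A B _ hB))
  match R, hQ, hz, aux with
  | .zero, hQ, hz, aux => exact aux (Or.inl rfl)
  | .some x y h, hQ, hz, aux =>
  have hE := ((nonsingular_curve_iff ..).1 h).1
  by_cases hx : x = 0
  · subst hx
    have hy : y = 0 := by simpa using hE
    subst hy
    exact aux (Or.inr rfl)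
  rw [isog_some h hx] at hQ
  match Q, hQ with
  | .zero, hQ => exact absurd hQ (Affine.Point.some_ne_zero _)
  | .some X Y hXY, hQ =>
  have hQ' := (Affine.Point.some.injEq ..).mp hQ
  obtain ⟨hX, hY⟩ := hQ'
  change _ = algebraMap K (AlgebraicClosure K) X at hX
  change _ = algebraMap K (AlgebraicClosure K) Y at hY
  by_cases hy : y = 0
  · subst hy
    have hq : x ^ 2 + A * x + B = 0 := mul_left_cancel₀ hx (by linear_combination -hE)
    refine ⟨A ^ 2 - 4 * B, Or.inr (Or.inl rfl), ?_⟩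
    rw [kummer, ← eq_kummerCocycle_of_fix_iff hB hz (w := 2 * x + A)
      (by simp [algebraMap_ofNat_four]; linear_combination 4 * hq)]
    intro σ
    rw [smul_some_eq_iff]
    simp [galK_two]
  · have hX0 : X ≠ 0 := by
      rintro rfl
      simp [hx, hy] at hX
    refine ⟨X, Or.inr (Or.inr ⟨hX0, Y, ?_⟩), ?_⟩
    · have := ((nonsingular_curve_iff ..).1 hXY).1
      push_cast at this
      linear_combination this
    rw [kummer, ← eq_kummerCocycle_of_fix_iff hB hz (w := y / x) (by rw [← hX, div_pow])]
    intro σ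
    rw [smul_some_eq_iff]
    constructor
    · intro hw
      obtain ⟨w, hwdef⟩ : ∃ w, w = y / x := ⟨_, rfl⟩
      rw [← hwdef] at hw
      have hw0 : w ≠ 0 := hwdef ▸ div_ne_zero hy hx
      have hyw : y = w * x := by rw [hwdef]; field_simp
      have hXw : w ^ 2 = algebraMap K (AlgebraicClosure K) X := by rw [← hX, hwdef, div_pow]
      -- `x` is determined by `X`, `Y` and the square root `w` of `X`
      have hxeq : x = (algebraMap K (AlgebraicClosure K) X - A -
          algebraMap K (AlgebraicClosure K) Y / w) / 2 := by
        rw [← hY, ← hXw, hyw]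
        have hq : w ^ 2 * x = x ^ 2 + A * x + B :=
          mul_left_cancel₀ hx (by rw [hyw] at hE; linear_combination hE)
        field_simp
        linear_combination -hq
      have hsx : σ x = x := by
        conv_lhs => rw [hxeq]
        conv_rhs => rw [hxeq]
        simp [hw, galK_two]
      refine ⟨hsx, ?_⟩
      rw [hyw, map_mul, hw, hsx]
    · rintro ⟨h1, h2⟩
      rw [map_div₀, h1, h2]

/-- Every quadratic character of an element of the descent set comes from a `K`-point of `E'`: an
explicit point of `E(K̄)` above it is moved by Galois through that character. -/
lemma subset_localCondition (hD : ((A ^ 2 - 4 * B : ℤ) : K) ≠ 0) :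
    kummer A hB '' descentSet A B K ⊆ localCondition A B K := by
  have hD' : (A ^ 2 - 4 * B : AlgebraicClosure K) ≠ 0 := by
    have := (map_ne_zero (algebraMap K (AlgebraicClosure K))).2 hD
    simpa [algebraMap_ofNat_four] using this
  rintro _ ⟨u, rfl | rfl | ⟨hu, Y, hY⟩, rfl⟩
  · refine ⟨0, 0, kummerCocycle A hB 1, rfl, fun σ => ?_, rfl⟩
    rw [kummerCocycle_apply hB (w := 1) (by simp)]
    simp
  · obtain ⟨w, hw⟩ := IsAlgClosed.exists_pow_nat_eq
      (algebraMap K (AlgebraicClosure K) (A ^ 2 - 4 * B)) two_pos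
    have hw' : w ^ 2 = A ^ 2 - 4 * B := by rw [hw]; simp [algebraMap_ofNat_four]
    have hw0 : w ≠ 0 := by
      rintro rfl
      exact hD' (by rw [← hw']; ring)
    obtain ⟨x, hxw⟩ : ∃ x, w = 2 * x + A := ⟨(w - A) / 2, by field_simp; ring⟩
    have hq : x ^ 2 + A * x + B = 0 := by
      rw [hxw] at hw'
      have : (4 : AlgebraicClosure K) * (x ^ 2 + A * x + B) = 0 := by linear_combination hw'
      simpa using this
    have hx : x ≠ 0 := by
      rintro rfl
      exact hB (by simpa using hq)
    refine kummer_mem_localCondition hB hw (x := x) (y := 0) (X := 0) (Y := 0) hx ?_ (by simp)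
      (by simp) (nonsingular_zero K hD) (fun σ hσ => ?_) (fun σ hσ => ?_)
    · rw [nonsingular_curve_iff]
      refine ⟨by linear_combination -x * hq, Or.inl ?_⟩
      have : 3 * x ^ 2 + 2 * A * x + B = x * w := by rw [hxw]; linear_combination hq
      rw [this]; exact mul_ne_zero hx hw0
    · simpa [hxw, galK_two] using hσ
    · rw [hxw] at hσ
      simp only [map_add, map_mul, galK_two, map_intCast] at hσ
      refine ⟨?_, by simp⟩
      have : σ x = - A - x :=
        mul_left_cancel₀ (two_ne_zero (α := AlgebraicClosure K)) (by linear_combination hσ)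
      rw [this]
      field_simp
      linear_combination -hq
  · obtain ⟨w, hw⟩ := IsAlgClosed.exists_pow_nat_eq
      (algebraMap K (AlgebraicClosure K) u) two_pos
    have hw0 : w ≠ 0 := by
      rintro rfl
      rw [zero_pow two_ne_zero] at hw
      exact hu ((map_eq_zero _).1 hw.symm)
    set Y' := algebraMap K (AlgebraicClosure K) Y with hY'
    have hYw : Y' ^ 2 = w ^ 2 * ((w ^ 2) ^ 2 - 2 * A * w ^ 2 + (A ^ 2 - 4 * B)) := by
      rw [hw, hY', ← map_pow, hY]; simp [algebraMap_ofNat_two, algebraMap_ofNat_four]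
    -- `x` and `B / x` have sum `w ^ 2 - A` and difference `- Y / w`.
    obtain ⟨x, hx⟩ : ∃ x, x = (w ^ 2 - A - Y' / w) / 2 := ⟨_, rfl⟩
    obtain ⟨x', hx'⟩ : ∃ x', x' = (w ^ 2 - A + Y' / w) / 2 := ⟨_, rfl⟩
    have hxx : x * x' = B := by
      rw [hx, hx']; field_simp; linear_combination -hYw
    have hsum : x + x' = w ^ 2 - A := by rw [hx, hx']; ring
    have hdiff : x' - x = Y' / w := by rw [hx, hx']; ring
    have hx0 : x ≠ 0 := fun h => hB (by rw [← hxx, h, zero_mul])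
    have hBx : (B : AlgebraicClosure K) / x = x' := by rw [← hxx]; field_simp
    have hBx2 : -(B : AlgebraicClosure K) * (w * x) / x ^ 2 = -w * x' := by
      rw [← hxx]; field_simp
    refine kummer_mem_localCondition hB hw (x := x) (y := w * x) (X := u) (Y := Y) hx0 ?_
      (by rw [← hw]; field_simp) ?_ ?_ (fun σ hσ => ?_) (fun σ hσ => ?_)
    · rw [nonsingular_curve_iff]
      refine ⟨by rw [← hxx]; linear_combination -x ^ 2 * hsum, Or.inr ?_⟩
      exact mul_ne_zero two_ne_zero (mul_ne_zero hw0 hx0)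
    · rw [← hxx, ← hY', eq_comm, ← mul_div_cancel₀ Y' hw0, mul_div_assoc, ← hdiff]
      field_simp
    · rw [isogCurve, nonsingular_curve_iff]
      push_cast at hD ⊢
      refine ⟨by linear_combination hY, ?_⟩
      by_contra! h0
      obtain ⟨h1, h2⟩ := h0
      have hY0 : Y = 0 := by simpa using h2
      rw [hY0, zero_pow two_ne_zero, zero_eq_mul, or_iff_right hu] at hY
      have h3 : (2 * u) * (u - A) = 0 := by linear_combination h1 - hY
      have h4 : u = A := sub_eq_zero.1 <| (mul_eq_zero.1 h3).resolve_left (by simpa using hu)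
      rw [h4] at hY
      have h5 : (4 : K) * B = 0 := by linear_combination -hY
      have h6 : (B : K) = 0 := by simpa using h5
      exact hB (by simpa using h6)
    · have : σ x = x := by rw [hx]; simp [hσ, hY', galK_two]
      exact ⟨this, by rw [map_mul, hσ, this]⟩
    · have : σ x = x' := by rw [hx, hx']; simp [hσ, hY', div_neg, galK_two]
      rw [hBx, hBx2]
      exact ⟨this, by rw [map_mul, hσ, this]⟩

/-- The image of the connecting map of a 2-isogeny, as a set of quadratic characters. -/
theorem localCondition_eq (hD : ((A ^ 2 - 4 * B : ℤ) : K) ≠ 0) :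
    localCondition A B K = kummer A hB '' descentSet A B K :=
  (localCondition_subset hB).antisymm (subset_localCondition hB hD)

end Image

/-! ### Rational 2-torsion -/

section Torsion

variable {A B : ℤ} {F : Type*} [Field F] [CharZero F]

/-- A 2-torsion point of `E` other than `O` and `(0, 0)` has for abscissa a root of `x² + A x + B`,
so there is none if the discriminant of this factor is not a square. -/
lemma torsionBy_two_eq (hsq : ¬ IsSquare ((A : F) ^ 2 - 4 * B)) (hB : (B : F) ≠ 0)
    (P : AddSubgroup.torsionBy (Pt (curve A B) F) 2) (hP : P ≠ 0) :
    (P : Pt (curve A B) F) = .some 0 0 (nonsingular_zero F hB) := by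
  obtain ⟨P, h2⟩ := P
  replace hP : P ≠ 0 := fun h => hP (Subtype.ext h)
  change P = _
  replace h2 : P + P = 0 := by
    rw [← two_zsmul]; exact (Submodule.mem_torsionBy_iff _ _).1 h2
  match P, h2, hP with
  | .zero, _, hP => exact absurd rfl hP
  | .some x y h, h2, _ =>
    have hE := ((nonsingular_curve_iff ..).1 h).1
    have hy : y = 0 := by
      have h3 := eq_neg_of_add_eq_zero_left h2
      rw [Affine.Point.neg_some, Affine.Point.some.injEq] at h3
      have h4 : y = -y := by
        simpa [Affine.negY, curve, WeierstrassCurve.baseChange, WeierstrassCurve.map] using h3.2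
      exact self_eq_neg.1 h4
    subst hy
    rcases eq_or_ne x 0 with rfl | hx
    · rfl
    · have hq : x ^ 2 + A * x + B = 0 := mul_left_cancel₀ hx (by linear_combination -hE)
      exact absurd ⟨2 * x + A, by linear_combination -4 * hq⟩ hsq

lemma isSquare_of_torsion_full (hB : (B : F) ≠ 0)
    (e : AddSubgroup.torsionBy (Pt (curve A B) F) 2 ≃+ ZMod 2 × ZMod 2) :
    IsSquare ((A : F) ^ 2 - 4 * B) := by
  by_contra hsq
  have h1 := torsionBy_two_eq hsq hB (e.symm (1, 0)) (by simp)
  have h2 := torsionBy_two_eq hsq hB (e.symm (0, 1)) (by simp)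
  have h3 := e.symm.injective (Subtype.ext (h1.trans h2.symm))
  simp at h3

lemma not_isSquare_of_torsion_cyclic (hB : (B : F) ≠ 0) (hD : (A : F) ^ 2 - 4 * B ≠ 0)
    (e : AddSubgroup.torsionBy (Pt (curve A B) F) 2 ≃+ ZMod 2) :
    ¬ IsSquare ((A : F) ^ 2 - 4 * B) := by
  rintro ⟨s, hs⟩
  have hs0 : s ≠ 0 := by rintro rfl; exact hD (by rw [hs, zero_mul])
  obtain ⟨x, rfl⟩ : ∃ x, s = 2 * x + A := ⟨(s - A) / 2, by field_simp; ring⟩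
  have hq : x ^ 2 + A * x + B = 0 := by
    have : (4 : F) * (x ^ 2 + A * x + B) = 0 := by linear_combination -hs
    simpa using this
  have hx : x ≠ 0 := by
    rintro rfl
    exact hB (by simpa using hq)
  have h : (bc (curve A B) F).toAffine.Nonsingular x 0 := by
    rw [nonsingular_curve_iff]
    refine ⟨by linear_combination -x * hq, Or.inl ?_⟩
    have : 3 * x ^ 2 + 2 * A * x + B = x * (2 * x + A) := by linear_combination hq
    rw [this]; exact mul_ne_zero hx hs0
  have mem {x : F} (h : (bc (curve A B) F).toAffine.Nonsingular x 0) :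
      (.some x 0 h : Pt (curve A B) F) ∈ AddSubgroup.torsionBy (Pt (curve A B) F) 2 := by
    refine (Submodule.mem_torsionBy_iff _ _).2 ?_
    rw [two_zsmul]
    refine Affine.Point.add_self_of_Y_eq ?_
    simp [Affine.negY, curve, WeierstrassCurve.baseChange, WeierstrassCurve.map]
  have three : ∀ a b c : ZMod 2, a = b ∨ a = c ∨ b = c := by decide
  rcases three (e 0) (e ⟨_, mem (nonsingular_zero F hB)⟩) (e ⟨_, mem h⟩) with h1 | h1 | h1
  · exact Affine.Point.some_ne_zero _ (congrArg Subtype.val (e.injective h1)).symm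
  · exact Affine.Point.some_ne_zero _ (congrArg Subtype.val (e.injective h1)).symm
  · have := congrArg Subtype.val (e.injective h1)
    exact hx ((Affine.Point.some.injEq ..).mp this).1.symm

end Torsion

/-! ### Squares in `ℚ_p` -/

section Padic

variable {p : ℕ} [Fact p.Prime]

lemma norm_two_eq_one (hp : p ≠ 2) : ‖(2 : ℚ_[p])‖ = 1 := by
  have : ‖((2 : ℤ) : ℚ_[p])‖ = 1 := by
    refine le_antisymm (Padic.norm_int_le_one _) (not_lt.1 fun h => hp ?_)
    rw [Padic.norm_intCast_lt_one_iff] at h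
    exact (Nat.prime_dvd_prime_iff_eq Fact.out Nat.prime_two).1 (by exact_mod_cast h)
  simpa using this

lemma isSquare_of_norm_sub_one_lt (hp : p ≠ 2) {x : ℚ_[p]} (hx : ‖x - 1‖ < 1) : IsSquare x := by
  have hx1 : ‖x‖ ≤ 1 := by
    have := Padic.nonarchimedean (p := p) (x - 1) 1
    simpa [hx.le] using this
  let y : ℤ_[p] := ⟨x, hx1⟩
  have h2 : ‖(2 : ℤ_[p])‖ = 1 := norm_two_eq_one hp
  obtain ⟨z, hz, -⟩ := hensels_lemma (p := p) (R := ℤ_[p])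
    (F := Polynomial.X ^ 2 - Polynomial.C y) (a := 1) (by
      simp only [Polynomial.derivative_sub, Polynomial.derivative_X_pow, Polynomial.derivative_C]
      simp [h2]
      rw [← norm_neg, neg_sub]
      exact hx)
  refine ⟨z, ?_⟩
  have hz' : z ^ 2 = y := by simpa [sub_eq_zero] using hz
  rw [← sq, ← PadicInt.coe_pow, hz']

lemma isSquare_mul_of_norm_sub_lt (hp : p ≠ 2) {s t : ℚ_[p]} (h : ‖t - s‖ < ‖s‖) :
    IsSquare (t * s) := by
  have hs : s ≠ 0 := by
    rintro rfl
    rw [norm_zero] at h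
    exact absurd h (norm_nonneg _).not_gt
  obtain ⟨r, hr⟩ := isSquare_of_norm_sub_one_lt hp (x := t / s) (by
    rw [← div_self hs, ← sub_div, norm_div]
    exact (div_lt_one (norm_pos_iff.2 hs)).2 h)
  refine ⟨r * s, ?_⟩
  have : t = r * r * s := by rw [← hr]; field_simp
  rw [this]; ring

lemma not_isSquare_of_norm_eq {d r : ℚ_[p]} (hd : ‖d‖ = (p : ℝ)⁻¹) (hr : ‖r‖ = 1) :
    ¬ IsSquare (d * r) := by
  rintro ⟨s, hs⟩
  have hp1 : (1 : ℝ) < p := by exact_mod_cast (Fact.out : p.Prime).one_lt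
  have hs0 : s ≠ 0 := by
    rintro rfl
    have := congrArg norm hs
    rw [norm_mul, hd, hr] at this
    simp at this
    exact absurd this (Fact.out : p.Prime).ne_zero
  have h1 := congrArg norm hs
  rw [norm_mul, hd, hr, norm_mul, Padic.norm_eq_zpow_neg_valuation hs0, mul_one,
    ← zpow_add₀ (by positivity), ← zpow_neg_one] at h1
  have := zpow_right_injective₀ (by positivity) hp1.ne' h1
  omega

lemma norm_eq_inv_of_squarefree {d : ℤ} (hd : Squarefree d) (hpd : (p : ℤ) ∣ d) :
    ‖(d : ℚ_[p])‖ = (p : ℝ)⁻¹ := by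
  obtain ⟨k, rfl⟩ := hpd
  have hk : ‖(k : ℚ_[p])‖ = 1 := by
    refine le_antisymm (Padic.norm_int_le_one _) (not_lt.1 fun h => ?_)
    rw [Padic.norm_intCast_lt_one_iff] at h
    obtain ⟨m, rfl⟩ := h
    have := hd p ⟨m, by ring⟩
    exact (Nat.prime_iff_prime_int.1 (Fact.out : p.Prime)).not_isUnit this
  simp [hk]

/-! ### Good reduction -/

/-- If `E` has good reduction, then `E : y² = x³ + A x² + B x` can be rescaled to an equation of
the same shape which is itself integral with unit discriminant. -/
lemma exists_scaling_of_goodReduction (hp : p ≠ 2) {A B : ℤ} (h : GoodReductionAt A B p) :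
    ∃ v : ℚ_[p], v ≠ 0 ∧ ‖v ^ 2 * A‖ ≤ 1 ∧ ‖v ^ 4 * B‖ = 1 ∧
      ‖(v ^ 2 * A) ^ 2 - 4 * (v ^ 4 * B)‖ = 1 := by
  obtain ⟨V, hV⟩ := h
  have h2 := norm_two_eq_one hp
  have h4 : ‖(4 : ℚ_[p])‖ = 1 := by
    rw [show (4 : ℚ_[p]) = 2 * 2 by norm_num, norm_mul, h2, one_mul]
  set W := V • bc (curve A B) ℚ_[p] with hW
  have int (x : ℤ_[p]) : ‖algebraMap ℤ_[p] ℚ_[p] x‖ ≤ 1 := x.2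
  have hb2 : ‖W.b₂‖ ≤ 1 := by rw [← integralModel_b₂_eq ℤ_[p] W]; exact int _
  have hb4 : ‖W.b₄‖ ≤ 1 := by rw [← integralModel_b₄_eq ℤ_[p] W]; exact int _
  have hb6 : ‖W.b₆‖ ≤ 1 := by rw [← integralModel_b₆_eq ℤ_[p] W]; exact int _
  have hΔ : ‖W.Δ‖ = 1 := by
    have h1 := hV.goodReduction
    rw [← integralModel_Δ_eq ℤ_[p] W] at h1 ⊢
    refine le_antisymm (int _) (not_lt.1 fun hlt => ?_)
    have h3 := (IsDedekindDomain.HeightOneSpectrum.valuation_lt_one_iff_mem (K := ℚ_[p])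
      (IsDiscreteValuationRing.maximalIdeal ℤ_[p]) (integralModel ℤ_[p] W).Δ).2 (by
        change _ ∈ IsLocalRing.maximalIdeal ℤ_[p]
        rw [IsLocalRing.mem_maximalIdeal, PadicInt.mem_nonunits]
        exact hlt)
    exact absurd h1 h3.ne
  rw [hW, variableChange_b₂] at hb2
  rw [hW, variableChange_b₄] at hb4
  rw [hW, variableChange_b₆] at hb6
  rw [hW, variableChange_Δ] at hΔ
  have e2 : (bc (curve A B) ℚ_[p]).b₂ = 4 * A := by
    simp [b₂, curve, WeierstrassCurve.baseChange, WeierstrassCurve.map]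
  have e4 : (bc (curve A B) ℚ_[p]).b₄ = 2 * B := by
    simp [b₄, curve, WeierstrassCurve.baseChange, WeierstrassCurve.map]
  have e6 : (bc (curve A B) ℚ_[p]).b₆ = 0 := by
    simp [b₆, curve, WeierstrassCurve.baseChange, WeierstrassCurve.map]
  have eΔ : (bc (curve A B) ℚ_[p]).Δ = 2 ^ 4 * (B ^ 2 * (A ^ 2 - 4 * B)) := by
    simp [Δ, b₈, b₂, b₄, b₆, curve, WeierstrassCurve.baseChange, WeierstrassCurve.map]
    ring
  rw [e2] at hb2
  rw [e2, e4] at hb4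
  rw [e2, e4, e6] at hb6
  rw [eΔ] at hΔ
  set v : ℚ_[p] := ((V.u⁻¹ : ℚ_[p]ˣ) : ℚ_[p]) with hv
  have hv0 : v ≠ 0 := Units.ne_zero _
  obtain ⟨ρ, hρ⟩ : ∃ ρ, ρ = v ^ 2 * V.r := ⟨_, rfl⟩
  obtain ⟨a, ha⟩ : ∃ a, a = v ^ 2 * (A : ℚ_[p]) := ⟨_, rfl⟩
  obtain ⟨b, hb⟩ : ∃ b, b = v ^ 4 * (B : ℚ_[p]) := ⟨_, rfl⟩
  obtain ⟨c₂, hc₂⟩ : ∃ c, c = v ^ 2 * (4 * A + 12 * V.r) := ⟨_, rfl⟩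
  obtain ⟨c₄, hc₄⟩ : ∃ c, c = v ^ 4 * (2 * B + V.r * (4 * A) + 6 * V.r ^ 2) := ⟨_, rfl⟩
  obtain ⟨c₆, hc₆⟩ : ∃ c, c = v ^ 6 * (0 + 2 * V.r * (2 * B) + V.r ^ 2 * (4 * A) + 4 * V.r ^ 3) :=
    ⟨_, rfl⟩
  rw [← hc₂] at hb2
  rw [← hc₄] at hb4
  rw [← hc₆] at hb6
  -- `-ρ` is the abscissa of a rational 2-torsion point on the integral model
  have hcubic : 4 * ρ ^ 3 = c₂ * ρ ^ 2 - 2 * c₄ * ρ + c₆ := by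
    rw [hρ, hc₂, hc₄, hc₆]; ring
  have add_le {x y : ℚ_[p]} {M : ℝ} (hx : ‖x‖ ≤ M) (hy : ‖y‖ ≤ M) : ‖x + y‖ ≤ M :=
    (Padic.nonarchimedean x y).trans (max_le hx hy)
  have sub_le {x y : ℚ_[p]} {M : ℝ} (hx : ‖x‖ ≤ M) (hy : ‖y‖ ≤ M) : ‖x - y‖ ≤ M := by
    rw [sub_eq_add_neg]; exact add_le hx (by rwa [norm_neg])
  have hρ1 : ‖ρ‖ ≤ 1 := by
    by_contra! hgt
    have hpos : 0 < ‖ρ‖ := by linarith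
    have h5 : ‖c₂ * ρ ^ 2 - 2 * c₄ * ρ + c₆‖ ≤ ‖ρ‖ ^ 2 := by
      refine add_le (sub_le ?_ ?_) ?_
      · rw [norm_mul, norm_pow]; exact mul_le_of_le_one_left (by positivity) hb2
      · rw [norm_mul, norm_mul, h2, one_mul]
        nlinarith [norm_nonneg c₄]
      · nlinarith
    rw [← hcubic, norm_mul, norm_pow, h4, one_mul] at h5
    nlinarith [sq_nonneg ‖ρ‖, mul_pos hpos hpos]
  have int_mul {x y : ℚ_[p]} (hx : ‖x‖ ≤ 1) (hy : ‖y‖ ≤ 1) : ‖x * y‖ ≤ 1 := by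
    rw [norm_mul]; exact mul_le_one₀ hx (norm_nonneg _) hy
  have int_nat (n : ℕ) : ‖(n : ℚ_[p])‖ ≤ 1 := by
    simpa using Padic.norm_int_le_one (p := p) (n : ℤ)
  have ha1 : ‖a‖ ≤ 1 := by
    have : 4 * a = c₂ - (12 : ℕ) * ρ := by rw [ha, hc₂, hρ]; push_cast; ring
    rw [← one_mul ‖a‖]
    nth_rw 1 [← h4]
    rw [← norm_mul, this]
    exact sub_le hb2 (int_mul (int_nat _) hρ1)
  have hb1 : ‖b‖ ≤ 1 := by
    have : 2 * b = c₄ - ρ * ((4 : ℕ) * a) - (6 : ℕ) * (ρ * ρ) := by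
      rw [ha, hb, hc₄, hρ]; push_cast; ring
    rw [← one_mul ‖b‖]
    nth_rw 1 [← h2]
    rw [← norm_mul, this]
    exact sub_le (sub_le hb4 (int_mul hρ1 (int_mul (int_nat _) ha1)))
      (int_mul (int_nat _) (int_mul hρ1 hρ1))
  have hD1 : ‖a ^ 2 - 4 * b‖ ≤ 1 :=
    sub_le (by rw [sq]; exact int_mul ha1 ha1) (int_mul h4.le hb1)
  have hprod : ‖b‖ * (‖b‖ * ‖a ^ 2 - 4 * b‖) = 1 := by
    have : v ^ 12 * (2 ^ 4 * ((B : ℚ_[p]) ^ 2 * (A ^ 2 - 4 * B))) =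
        2 ^ 4 * (b * (b * (a ^ 2 - 4 * b))) := by rw [ha, hb]; ring
    rw [this, norm_mul, norm_pow, h2, one_pow, one_mul, norm_mul, norm_mul] at hΔ
    exact hΔ
  have hbD : ‖b‖ * ‖a ^ 2 - 4 * b‖ ≤ 1 := mul_le_one₀ hb1 (norm_nonneg _) hD1
  have hb' : ‖b‖ = 1 := le_antisymm hb1 <| by
    rw [← hprod]; exact mul_le_of_le_one_right (norm_nonneg _) hbD
  have hD' : ‖a ^ 2 - 4 * b‖ = 1 := by rw [hb', one_mul, one_mul] at hprod; exact hprod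
  rw [ha] at ha1
  rw [hb] at hb'
  rw [ha, hb] at hD'
  exact ⟨v, hv0, ha1, hb', hD'⟩

end Padic

/-! ### Small subspaces of `𝔽₂`-vector spaces -/

section Dimension

variable {V : Type*} [AddCommGroup V] [Module (ZMod 2) V]

lemma isSubspaceOfDim_zero : IsSubspaceOfDim ({0} : Set V) 0 :=
  ⟨⊥, rfl, by simp⟩

lemma isSubspaceOfDim_one {v : V} (hv : v ≠ 0) : IsSubspaceOfDim ({0, v} : Set V) 1 := by
  have hli : LinearIndependent (ZMod 2) ![v] :=
    LinearIndependent.of_subsingleton (i := 0) (by simpa using hv)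
  refine ⟨Submodule.span (ZMod 2) (Set.range ![v]), ?_, ?_⟩
  · ext x
    simp only [Matrix.range_cons, Matrix.range_empty, Set.union_empty, SetLike.mem_coe,
      Submodule.mem_span_singleton]
    have two : ∀ a : ZMod 2, a = 0 ∨ a = 1 := by decide
    constructor
    · rintro ⟨a, rfl⟩
      rcases two a with rfl | rfl <;> simp
    · rintro (rfl | rfl)
      exacts [⟨0, by simp⟩, ⟨1, by simp⟩]
  · rw [rank_eq_card_basis (Module.Basis.span hli)]
    simp

lemma isSubspaceOfDim_two {v w : V} (hv : v ≠ 0) (hw : w ≠ 0) (hvw : v + w ≠ 0) :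
    IsSubspaceOfDim ({0, v, w, v + w} : Set V) 2 := by
  have two : ∀ a : ZMod 2, a = 0 ∨ a = 1 := by decide
  have hli : LinearIndependent (ZMod 2) ![v, w] := by
    rw [LinearIndependent.pair_iff]
    intro s t h
    rcases two s with rfl | rfl <;> rcases two t with rfl | rfl <;> simp_all
  refine ⟨Submodule.span (ZMod 2) (Set.range ![v, w]), ?_, ?_⟩
  · ext x
    simp only [Matrix.range_cons, Matrix.range_empty, Set.union_empty, SetLike.mem_coe,
      Set.singleton_union, Submodule.mem_span_pair]
    constructor
    · rintro ⟨a, b, rfl⟩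
      rcases two a with rfl | rfl <;> rcases two b with rfl | rfl <;> simp
    · rintro (rfl | rfl | rfl | rfl)
      exacts [⟨0, 0, by simp⟩, ⟨1, 0, by simp⟩, ⟨0, 1, by simp⟩, ⟨1, 1, by simp⟩]
  · rw [rank_eq_card_basis (Module.Basis.span hli)]
    simp

end Dimension

/-! ### Square classes of the `x`-coordinates on a ramified twist -/

section Descent

variable {p : ℕ} [Fact p.Prime]

/-- An equation `Y² = d t (t² - 2 a t + c)` over `ℚ_p`, with `d` a uniformizer and with unit
discriminants `c` and `4 b = a² - c`, restricts the square class of `d t`. -/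
lemma square_class_of_twisted_point (hp : p ≠ 2) {d a b t y : ℚ_[p]} (hd : ‖d‖ = (p : ℝ)⁻¹)
    (ha : ‖a‖ ≤ 1) (hb : ‖b‖ = 1) (hc : ‖a ^ 2 - 4 * b‖ = 1) (ht : t ≠ 0)
    (hy : y ^ 2 = d * t * (t ^ 2 - 2 * a * t + (a ^ 2 - 4 * b))) :
    IsSquare (d * t) ∨ IsSquare (d * t * (a ^ 2 - 4 * b)) ∨
      ∃ β, b = β ^ 2 ∧ (IsSquare (t * (a + 2 * β)) ∨ IsSquare (t * (a - 2 * β))) := by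
  have h2 := norm_two_eq_one hp
  obtain ⟨c, hcdef⟩ : ∃ c, c = a ^ 2 - 4 * b := ⟨_, rfl⟩
  obtain ⟨g, hg⟩ : ∃ g, g = t ^ 2 - 2 * a * t + c := ⟨_, rfl⟩
  rw [← hcdef] at hc ⊢
  rw [← hcdef, ← hg] at hy
  have hc0 : c ≠ 0 := by rintro rfl; simp at hc
  have hat : ‖2 * a * t‖ ≤ ‖t‖ := by
    rw [norm_mul, norm_mul, h2, one_mul]
    exact mul_le_of_le_one_left (norm_nonneg _) ha
  rcases lt_trichotomy ‖t‖ 1 with hlt | heq | hgt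
  · -- `t` is divisible by `p`: the quadratic factor is a square times `c`
    right; left
    have hclose : ‖g - c‖ < ‖c‖ := by
      have : g - c = t ^ 2 + -(2 * a * t) := by rw [hg]; ring
      rw [this, hc]
      refine (Padic.nonarchimedean _ _).trans_lt (max_lt ?_ ?_)
      · rw [norm_pow]; exact pow_lt_one₀ (norm_nonneg _) hlt two_ne_zero
      · rw [norm_neg]; exact hat.trans_lt hlt
    have hg0 : g ≠ 0 := by
      rintro rfl
      rw [zero_sub, norm_neg] at hclose
      exact hclose.false
    obtain ⟨s, hs⟩ := isSquare_mul_of_norm_sub_lt hp hclose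
    refine ⟨y * s / g, ?_⟩
    have : y * s / g * (y * s / g) = y ^ 2 * (s * s) / g ^ 2 := by ring
    rw [this, hy, ← hs]
    field_simp
  · -- `t` is a unit: by parity of valuations it is a root of the quadratic factor modulo `p`
    right; right
    have hg1 : ‖g‖ ≤ 1 := by
      have : g = (t ^ 2 + -(2 * a * t)) + c := by rw [hg]; ring
      rw [this]
      refine (Padic.nonarchimedean _ _).trans (max_le ?_ hc.le)
      refine (Padic.nonarchimedean _ _).trans (max_le ?_ ?_)
      · rw [norm_pow, heq, one_pow]
      · rw [norm_neg, ← heq]; exact hat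
    have hglt : ‖g‖ < 1 := by
      refine lt_of_le_of_ne hg1 fun h => ?_
      refine not_isSquare_of_norm_eq hd (r := t * g) (by rw [norm_mul, heq, h, one_mul]) ⟨y, ?_⟩
      rw [← sq, hy]; ring
    have h4b : ‖4 * b‖ = 1 := by
      rw [show 4 * b = 2 * (2 * b) by ring, norm_mul, norm_mul, h2, hb, one_mul, one_mul]
    have hsq : IsSquare ((t - a) ^ 2 * (4 * b)) := by
      refine isSquare_mul_of_norm_sub_lt hp ?_
      have : (t - a) ^ 2 - 4 * b = g := by rw [hg, hcdef]; ring
      rw [this, h4b]; exact hglt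
    have hta : t - a ≠ 0 := by
      intro h
      have : g = -(4 * b) := by rw [hg, hcdef, sub_eq_zero.1 h]; ring
      rw [this, norm_neg, h4b] at hglt
      exact hglt.false
    obtain ⟨s, hs⟩ := hsq
    have hβ : b = (s / (2 * (t - a))) ^ 2 := by
      rw [div_pow, sq s, ← hs]; field_simp; norm_num
    obtain ⟨β, hβdef⟩ : ∃ β, β = s / (2 * (t - a)) := ⟨_, rfl⟩
    rw [← hβdef] at hβ
    refine ⟨β, hβ, ?_⟩
    have hfac : g = (t - (a + 2 * β)) * (t - (a - 2 * β)) := by rw [hg, hcdef, hβ]; ring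
    have hβ1 : ‖2 * β‖ = 1 := by
      have : ‖2 * β‖ ^ 2 = 1 := by
        rw [← norm_pow, ← h4b, hβ]; congr 1; ring
      exact (pow_eq_one_iff_of_nonneg (norm_nonneg _) two_ne_zero).1 this
    have hr1 : ‖a + 2 * β‖ ≤ 1 := (Padic.nonarchimedean _ _).trans (max_le ha hβ1.le)
    have hr2 : ‖a - 2 * β‖ ≤ 1 := by
      rw [sub_eq_add_neg]
      exact (Padic.nonarchimedean _ _).trans (max_le ha (by rw [norm_neg]; exact hβ1.le))
    have hr : ‖a + 2 * β‖ * ‖a - 2 * β‖ = 1 := by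
      rw [← norm_mul, ← hc, hcdef, hβ]; congr 1; ring
    have hr1' : 1 ≤ ‖a + 2 * β‖ := by
      rw [← hr]; exact mul_le_of_le_one_right (norm_nonneg _) hr2
    have hr2' : 1 ≤ ‖a - 2 * β‖ := by
      rw [← hr]; exact mul_le_of_le_one_left (norm_nonneg _) hr1
    by_cases h1 : ‖t - (a + 2 * β)‖ < 1
    · exact Or.inl (isSquare_mul_of_norm_sub_lt hp (h1.trans_le hr1'))
    · refine Or.inr (isSquare_mul_of_norm_sub_lt hp (lt_of_lt_of_le ?_ hr2'))
      rw [hfac, norm_mul] at hglt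
      by_contra! h3
      exact (one_le_mul_of_one_le_of_one_le (not_lt.1 h1) h3).not_gt hglt
  · -- `t` has a pole: the quadratic factor is close to `t ^ 2`
    left
    have hclose : ‖g - t ^ 2‖ < ‖t ^ 2‖ := by
      have : g - t ^ 2 = -(2 * a * t) + c := by rw [hg]; ring
      have ht2 : ‖t‖ < ‖t ^ 2‖ := by rw [norm_pow]; nlinarith
      rw [this]
      refine (Padic.nonarchimedean _ _).trans_lt (max_lt ?_ ?_)
      · rw [norm_neg]; exact hat.trans_lt ht2
      · rw [hc]; exact hgt.trans ht2
    have hg0 : g ≠ 0 := by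
      rintro rfl
      rw [zero_sub, norm_neg] at hclose
      exact hclose.false
    obtain ⟨s, hs⟩ := isSquare_mul_of_norm_sub_lt hp hclose
    refine ⟨y * s / (g * t), ?_⟩
    have : y * s / (g * t) * (y * s / (g * t)) = y ^ 2 * (s * s) / (g * t) ^ 2 := by ring
    rw [this, hy, ← hs]
    field_simp

end Descent

/-! ### The image of the descent set -/

section Main

variable {p : ℕ} [Fact p.Prime] {A B d : ℤ}

/-- The image of the descent set of the twist by a uniformizer `d`. Apart from the class of the
discriminant `A² - 4B`, which comes from `(0, 0)`, the only classes are those of the two remaining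
2-torsion points of `E'^d`; these exist when `B` is a square, and have odd valuation. The scalar `v`
rescales `E` to an equation with good reduction. -/
lemma kummer_image_twist {a b : ℤ} (hb : (b : AlgebraicClosure ℚ_[p]) ≠ 0) (hp : p ≠ 2)
    (hA : a = d * A) (hB : b = d ^ 2 * B) (hd : ‖(d : ℚ_[p])‖ = (p : ℝ)⁻¹)
    {v : ℚ_[p]} (hv : v ≠ 0) (h1 : ‖v ^ 2 * A‖ ≤ 1) (h2 : ‖v ^ 4 * B‖ = 1)
    (h3 : ‖(v ^ 2 * A) ^ 2 - 4 * (v ^ 4 * B)‖ = 1) :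
    (¬ IsSquare (B : ℚ_[p]) → kummer a hb '' descentSet a b ℚ_[p] =
      {0, kummer a hb ((A : ℚ_[p]) ^ 2 - 4 * B)}) ∧
    (IsSquare (B : ℚ_[p]) → ∃ s : ℚ_[p], s ≠ 0 ∧ ¬ IsSquare s ∧
      ¬ IsSquare (((A : ℚ_[p]) ^ 2 - 4 * B) * s) ∧
      kummer a hb '' descentSet a b ℚ_[p] = {0, kummer a hb ((A : ℚ_[p]) ^ 2 - 4 * B),
        kummer a hb s, kummer a hb ((A : ℚ_[p]) ^ 2 - 4 * B) + kummer a hb s}) := by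
  have hv2 : v ^ 2 ≠ 0 := pow_ne_zero 2 hv
  have hp0 : (p : ℝ) ≠ 0 := by exact_mod_cast (Fact.out : p.Prime).ne_zero
  have hd0 : (d : ℚ_[p]) ≠ 0 := by
    intro h
    rw [h, norm_zero] at hd
    exact inv_ne_zero hp0 hd.symm
  have ha' : (a : ℚ_[p]) = d * A := by rw [hA]; push_cast; rfl
  have hb' : (b : ℚ_[p]) = d ^ 2 * B := by rw [hB]; push_cast; rfl
  obtain ⟨D, hD⟩ : ∃ D, D = (A : ℚ_[p]) ^ 2 - 4 * B := ⟨_, rfl⟩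
  rw [← hD]
  have hvD : (v ^ 2 * A) ^ 2 - 4 * (v ^ 4 * B) = v ^ 4 * D := by rw [hD]; ring
  have hD0 : D ≠ 0 := by
    rintro rfl
    rw [hvD] at h3
    simp at h3
  have hdD : (a : ℚ_[p]) ^ 2 - 4 * b = d ^ 2 * D := by rw [ha', hb', hD]; ring
  have hone : kummer a hb 1 = 0 := (kummer_eq_zero_iff hb).2 ⟨1, by ring⟩
  have hdisc : kummer a hb ((a : ℚ_[p]) ^ 2 - 4 * b) = kummer a hb D := by
    rw [hdD, kummer_eq_iff hb (mul_ne_zero (pow_ne_zero 2 hd0) hD0) hD0]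
    exact ⟨d * D, by ring⟩
  have hpoint {x Y : ℚ_[p]} (hx : x ≠ 0)
      (hY : Y ^ 2 = x * (x ^ 2 - 2 * a * x + (a ^ 2 - 4 * b))) :
      kummer a hb x = 0 ∨ kummer a hb x = kummer a hb D ∨
        ∃ β, v ^ 4 * B = β ^ 2 ∧ (IsSquare (x * (d * (v ^ 2 * A + 2 * β) / v ^ 2)) ∨
          IsSquare (x * (d * (v ^ 2 * A - 2 * β) / v ^ 2))) := by
    obtain ⟨t, rfl⟩ : ∃ t, x = d * t / v ^ 2 := ⟨x * v ^ 2 / d, by field_simp⟩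
    have ht : t ≠ 0 := by rintro rfl; simp at hx
    have hy : (Y * v ^ 3 / d) ^ 2 = d * t *
        (t ^ 2 - 2 * (v ^ 2 * A) * t + ((v ^ 2 * A) ^ 2 - 4 * (v ^ 4 * B))) := by
      rw [div_pow, mul_pow, hY, ha', hb']
      field_simp
    rcases square_class_of_twisted_point hp hd h1 h2 h3 ht hy with
      ⟨s, hs⟩ | ⟨s, hs⟩ | ⟨β, hβ, ⟨s, hs⟩ | ⟨s, hs⟩⟩
    · left
      rw [kummer_eq_zero_iff, hs]
      exact ⟨s / v, by field_simp⟩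
    · right; left
      rw [kummer_eq_iff hb hx hD0]
      refine ⟨s / v ^ 3, ?_⟩
      have : s / v ^ 3 * (s / v ^ 3) = s * s / v ^ 6 := by field_simp
      rw [this, ← hs, hvD]
      field_simp
    · refine Or.inr (Or.inr ⟨β, hβ, Or.inl ⟨d * s / v ^ 2, ?_⟩⟩)
      have : d * s / v ^ 2 * (d * s / v ^ 2) = d ^ 2 * (s * s) / v ^ 4 := by field_simp
      rw [this, ← hs]
      field_simp
    · refine Or.inr (Or.inr ⟨β, hβ, Or.inr ⟨d * s / v ^ 2, ?_⟩⟩)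
      have : d * s / v ^ 2 * (d * s / v ^ 2) = d ^ 2 * (s * s) / v ^ 4 := by field_simp
      rw [this, ← hs]
      field_simp
  constructor
  · intro hBsq
    apply Set.Subset.antisymm
    · rintro _ ⟨x, rfl | rfl | ⟨hx, Y, hY⟩, rfl⟩
      · exact Or.inl hone
      · exact Or.inr hdisc
      · rcases hpoint hx hY with h | h | ⟨β, hβ, -⟩
        · exact Or.inl h
        · exact Or.inr h
        · refine absurd ⟨β / v ^ 2, ?_⟩ hBsq
          have : β / v ^ 2 * (β / v ^ 2) = β ^ 2 / v ^ 4 := by field_simp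
          rw [this, ← hβ]; field_simp
    · rintro _ (rfl | rfl)
      · exact ⟨1, Or.inl rfl, hone⟩
      · exact ⟨_, Or.inr (Or.inl rfl), hdisc⟩
  · rintro ⟨β₀, hβ₀⟩
    obtain ⟨β, hβdef⟩ : ∃ β, β = v ^ 2 * β₀ := ⟨_, rfl⟩
    have hβ : v ^ 4 * B = β ^ 2 := by rw [hβdef, hβ₀]; ring
    obtain ⟨r, hr⟩ : ∃ r, r = v ^ 2 * A + 2 * β := ⟨_, rfl⟩
    obtain ⟨r', hr'⟩ : ∃ r', r' = v ^ 2 * A - 2 * β := ⟨_, rfl⟩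
    have hrr : r * r' = v ^ 4 * D := by rw [← hvD, hβ, hr, hr']; ring
    have hr0 : r ≠ 0 := left_ne_zero_of_mul (hrr ▸ mul_ne_zero (pow_ne_zero 4 hv) hD0)
    have hr0' : r' ≠ 0 := right_ne_zero_of_mul (hrr ▸ mul_ne_zero (pow_ne_zero 4 hv) hD0)
    -- `s` and `s'` are the abscissas of the two 2-torsion points of `E'^d` other than `(0, 0)`
    obtain ⟨s, hs⟩ : ∃ s, s = d * r / v ^ 2 := ⟨_, rfl⟩
    obtain ⟨s', hs'⟩ : ∃ s', s' = d * r' / v ^ 2 := ⟨_, rfl⟩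
    have hs0 : s ≠ 0 := hs ▸ div_ne_zero (mul_ne_zero hd0 hr0) hv2
    have hs0' : s' ≠ 0 := hs' ▸ div_ne_zero (mul_ne_zero hd0 hr0') hv2
    have hss : s * s' = d ^ 2 * D := by
      have : s * s' = d ^ 2 * (r * r') / v ^ 4 := by rw [hs, hs']; field_simp
      rw [this, hrr]; field_simp
    have hkum : kummer a hb s' = kummer a hb D + kummer a hb s := by
      rw [← kummer_mul hb hD0 hs0, kummer_eq_iff hb hs0' (mul_ne_zero hD0 hs0)]
      exact ⟨d * D, by linear_combination D * hss⟩
    have hnorm : ‖r‖ = 1 := by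
      have h5 : ‖r * r'‖ = 1 := by rw [hrr, ← hvD, h3]
      have h2' := norm_two_eq_one hp
      have hβ1 : ‖2 * β‖ = 1 := by
        rw [norm_mul, h2', one_mul]
        refine (pow_eq_one_iff_of_nonneg (norm_nonneg _) two_ne_zero).1 ?_
        rw [← norm_pow, ← hβ, h2]
      have hr1 : ‖r‖ ≤ 1 := hr ▸ (Padic.nonarchimedean _ _).trans (max_le h1 hβ1.le)
      have hr2 : ‖r'‖ ≤ 1 := by
        rw [hr', sub_eq_add_neg]
        exact (Padic.nonarchimedean _ _).trans (max_le h1 (by rw [norm_neg]; exact hβ1.le))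
      refine le_antisymm hr1 ?_
      rw [← h5, norm_mul]
      exact mul_le_of_le_one_right (norm_nonneg _) hr2
    refine ⟨s, hs0, ?_, ?_, ?_⟩
    · rintro ⟨m, hm⟩
      refine not_isSquare_of_norm_eq hd hnorm ⟨v * m, ?_⟩
      have : v * m * (v * m) = v ^ 2 * (m * m) := by ring
      rw [this, ← hm, hs]; field_simp
    · rintro ⟨m, hm⟩
      refine not_isSquare_of_norm_eq hd (r := r * (v ^ 4 * D))
        (by rw [norm_mul, hnorm, ← hvD, h3, one_mul]) ⟨v ^ 3 * m, ?_⟩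
      have : v ^ 3 * m * (v ^ 3 * m) = v ^ 6 * (m * m) := by ring
      rw [this, ← hm, hs]; field_simp
    apply Set.Subset.antisymm
    · rintro _ ⟨x, rfl | rfl | ⟨hx, Y, hY⟩, rfl⟩
      · exact Or.inl hone
      · exact Or.inr (Or.inl hdisc)
      · rcases hpoint hx hY with h | h | ⟨β', hβ', h⟩
        · exact Or.inl h
        · exact Or.inr (Or.inl h)
        · have key : IsSquare (x * s) ∨ IsSquare (x * s') := by
            rcases sq_eq_sq_iff_eq_or_eq_neg.1 (hβ'.symm.trans hβ) with rfl | rfl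
            · rwa [← hr, ← hr', ← hs, ← hs'] at h
            · rw [mul_neg, sub_neg_eq_add, ← sub_eq_add_neg, ← hr, ← hr', ← hs, ← hs'] at h
              exact h.symm
          rcases key with h | h
          · exact Or.inr (Or.inr (Or.inl ((kummer_eq_iff hb hx hs0).2 h)))
          · exact Or.inr (Or.inr (Or.inr (((kummer_eq_iff hb hx hs0').2 h).trans hkum)))
    · rintro _ (rfl | rfl | rfl | rfl)
      · exact ⟨1, Or.inl rfl, hone⟩
      · exact ⟨_, Or.inr (Or.inl rfl), hdisc⟩
      · refine ⟨s, Or.inr (Or.inr ⟨hs0, 0, ?_⟩), rfl⟩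
        have : s ^ 2 - 2 * a * s + (a ^ 2 - 4 * b) = 0 := by
          have hsum : s + s' = 2 * a := by
            rw [hs, hs', hr, hr', ha']; field_simp; ring
          rw [hdD, ← hss, ← hsum]; ring
        rw [this]; ring
      · refine ⟨s', Or.inr (Or.inr ⟨hs0', 0, ?_⟩), hkum⟩
        have : s' ^ 2 - 2 * a * s' + (a ^ 2 - 4 * b) = 0 := by
          have hsum : s + s' = 2 * a := by
            rw [hs, hs', hr, hr', ha']; field_simp; ring
          rw [hdD, ← hss, ← hsum]; ring
        rw [this]; ring

end Main

end TwoIsogeny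

end

theorem lemma3p1 (A B : ℤ) (hE : (TwoIsogeny.bc (TwoIsogeny.curve A B) ℚ).IsElliptic)
    (p : ℕ) [Fact p.Prime] (hp : p ≠ 2) (hgood : TwoIsogeny.GoodReductionAt A B p)
    (d : ℤ) (hd : Squarefree d) (hpd : (p : ℤ) ∣ d) :
    (TwoIsogeny.TwoTorsionCyclic (TwoIsogeny.curve A B) p →
      TwoIsogeny.TwoTorsionCyclic (TwoIsogeny.isogCurve A B) p →
      TwoIsogeny.IsSubspaceOfDim (TwoIsogeny.twistLocalCondition A B d p) 1) ∧
    (TwoIsogeny.TwoTorsionFull (TwoIsogeny.curve A B) p →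
      TwoIsogeny.TwoTorsionFull (TwoIsogeny.isogCurve A B) p →
      TwoIsogeny.IsSubspaceOfDim (TwoIsogeny.twistLocalCondition A B d p) 1) ∧
    (TwoIsogeny.TwoTorsionCyclic (TwoIsogeny.curve A B) p →
      TwoIsogeny.TwoTorsionFull (TwoIsogeny.isogCurve A B) p →
      TwoIsogeny.IsSubspaceOfDim (TwoIsogeny.twistLocalCondition A B d p) 2) ∧
    (TwoIsogeny.TwoTorsionFull (TwoIsogeny.curve A B) p →
      TwoIsogeny.TwoTorsionCyclic (TwoIsogeny.isogCurve A B) p →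
      TwoIsogeny.IsSubspaceOfDim (TwoIsogeny.twistLocalCondition A B d p) 0) := by
  have hd' := TwoIsogeny.norm_eq_inv_of_squarefree (p := p) hd hpd
  obtain ⟨v, hv, h1, h2, h3⟩ := TwoIsogeny.exists_scaling_of_goodReduction hp hgood
  have hB : (B : ℚ_[p]) ≠ 0 := by
    intro h
    rw [h] at h2
    simp at h2
  have hD : (A : ℚ_[p]) ^ 2 - 4 * B ≠ 0 := by
    intro h
    have : (v ^ 2 * A) ^ 2 - 4 * (v ^ 4 * B) = v ^ 4 * ((A : ℚ_[p]) ^ 2 - 4 * B) := by ring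
    rw [this, h] at h3
    simp at h3
  have hd0 : (d : ℚ_[p]) ≠ 0 := by exact_mod_cast hd.ne_zero
  have hB0 : B ≠ 0 := by exact_mod_cast hB
  have hb : ((d ^ 2 * B : ℤ) : AlgebraicClosure ℚ_[p]) ≠ 0 := by
    exact_mod_cast mul_ne_zero (pow_ne_zero 2 hd.ne_zero) hB0
  have hdisc : (((d * A) ^ 2 - 4 * (d ^ 2 * B) : ℤ) : ℚ_[p]) ≠ 0 := by
    have : (((d * A) ^ 2 - 4 * (d ^ 2 * B) : ℤ) : ℚ_[p]) =
        (d : ℚ_[p]) ^ 2 * ((A : ℚ_[p]) ^ 2 - 4 * B) := by push_cast; ring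
    rw [this]
    exact mul_ne_zero (pow_ne_zero 2 hd0) hD
  have himage := TwoIsogeny.kummer_image_twist hb hp rfl rfl hd' hv h1 h2 h3
  have hloc : TwoIsogeny.twistLocalCondition A B d p = _ := TwoIsogeny.localCondition_eq hb hdisc
  rw [← hloc] at himage
  obtain ⟨hns, hsq⟩ := himage
  have hB' : ((A ^ 2 - 4 * B : ℤ) : ℚ_[p]) ≠ 0 := by exact_mod_cast hD
  -- the quadratic factor of the equation of `E'` has discriminant `16 B`
  have hdisc' : (((-2 * A : ℤ) : ℚ_[p])) ^ 2 - 4 * ((A ^ 2 - 4 * B : ℤ) : ℚ_[p]) =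
      4 ^ 2 * B := by push_cast; ring
  have sq16 : IsSquare ((4 : ℚ_[p]) ^ 2 * B) ↔ IsSquare (B : ℚ_[p]) := by
    constructor
    · rintro ⟨s, hs⟩
      exact ⟨s / 4, by field_simp; linear_combination hs⟩
    · rintro ⟨s, hs⟩
      exact ⟨4 * s, by rw [hs]; ring⟩
  have full : TwoIsogeny.TwoTorsionFull (TwoIsogeny.curve A B) p →
      TwoIsogeny.kummer (d * A) hb ((A : ℚ_[p]) ^ 2 - 4 * B) = 0 := fun ⟨e⟩ =>
    (TwoIsogeny.kummer_eq_zero_iff hb).2 (TwoIsogeny.isSquare_of_torsion_full hB e)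
  have cyc : TwoIsogeny.TwoTorsionCyclic (TwoIsogeny.curve A B) p →
      TwoIsogeny.kummer (d * A) hb ((A : ℚ_[p]) ^ 2 - 4 * B) ≠ 0 := fun ⟨e⟩ h =>
    TwoIsogeny.not_isSquare_of_torsion_cyclic hB hD e ((TwoIsogeny.kummer_eq_zero_iff hb).1 h)
  have full' : TwoIsogeny.TwoTorsionFull (TwoIsogeny.isogCurve A B) p →
      IsSquare (B : ℚ_[p]) := fun ⟨e⟩ => by
    rw [← sq16, ← hdisc']; exact TwoIsogeny.isSquare_of_torsion_full hB' e
  have cyc' : TwoIsogeny.TwoTorsionCyclic (TwoIsogeny.isogCurve A B) p →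
      ¬ IsSquare (B : ℚ_[p]) := fun ⟨e⟩ => by
    rw [← sq16, ← hdisc']
    refine TwoIsogeny.not_isSquare_of_torsion_cyclic hB' ?_ e
    rw [hdisc']
    exact mul_ne_zero (by norm_num) hB
  refine ⟨fun hE hE' => ?_, fun hE hE' => ?_, fun hE hE' => ?_, fun hE hE' => ?_⟩
  · rw [hns (cyc' hE')]
    exact TwoIsogeny.isSubspaceOfDim_one (cyc hE)
  · obtain ⟨s, -, hs, -, himg⟩ := hsq (full' hE')
    rw [himg, full hE, zero_add, Set.insert_eq_of_mem (Set.mem_insert _ _), Set.pair_eq_singleton]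
    exact TwoIsogeny.isSubspaceOfDim_one (mt (TwoIsogeny.kummer_eq_zero_iff hb).1 hs)
  · obtain ⟨s, hs0, hs, hDs, himg⟩ := hsq (full' hE')
    rw [himg]
    refine TwoIsogeny.isSubspaceOfDim_two (cyc hE)
      (mt (TwoIsogeny.kummer_eq_zero_iff hb).1 hs) ?_
    rw [← TwoIsogeny.kummer_mul hb hD hs0]
    exact mt (TwoIsogeny.kummer_eq_zero_iff hb).1 hDs
  · rw [hns (cyc' hE'), full hE, Set.pair_eq_singleton]
    exact TwoIsogeny.isSubspaceOfDim_zero
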